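/- Let $m,p\ge 1$. An $m\times p$ \emph{Cauchon diagram} $C$ is an $m\times p$ grid of boxes $(i,\alpha)$, $1\le i\le m$, $1\le\alpha\le p$ (row $i$, column $\alpha$), some of which are coloured black (the others are white), such that whenever a box is black, either all boxes strictly to its left in its row are black or all boxes strictly above it in its column are black. We write $(i,\alpha)\in C$ if $(i,\alpha)$ is black. \emph{Cauchon reduction.} For a real $m\times p$ matrix $M$, run through the boxes $(j,\beta)\neq(1,1)$ in decreasing lexicographic order, starting with the matrix $M$. At the box $(j,\beta)$, if the current matrix is $(x_{i,\alpha})$ and $x_{j,\beta}\ne 0$, replace $x_{i,\alpha}$ by $x_{i,\alpha}-x_{i,\beta}x_{j,\beta}^{-1}x_{j,\alpha}$ for all $i<j$, $\alpha<\beta$ and leave the other entries unchanged; if $x_{j,\beta}=0$, change nothing. The final matrix is denoted $\widetilde M=(t_{i,\alpha})$. A real matrix is \emph{totally nonnegative} (tnn) if all its minors are $\ge 0$; here $[i_0\dots i_t\,|\,\alpha_0\dots\alpha_t](M)$ is the minor of $M$ with rows $i_0<\dots<i_t$ and columns $\alpha_0<\dots<\alpha_t$. For a Cauchon diagram $C$,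 the tnn cell $S^0_C$ is the set of tnn $m\times p$ matrices $M$ such that, for all $(i,\alpha)$, $t_{i,\alpha}=0$ if and only if $(i,\alpha)\in C$. A sequence of boxes $((i_0,\alpha_0),\dots,(i_t,\alpha_t))$ is \emph{lacunary} with respect to $C$ if 1. $t\ge 0$; 2. the boxes $(i_1,\alpha_1),\dots,(i_t,\alpha_t)$ are white; 3. $1\le i_0<\dots<i_t\le m$ and $1\le\alpha_0<\dots<\alpha_t\le p$; 4. every box $(i,\alpha)$ with $i>i_t$ and $\alpha>\alpha_t$ is black; 5. for each $s\in\{0,\dots,t-1\}$, either all boxes $(i,\alpha)$ with $i_s<i<i_{s+1}$ and $\alpha_s<\alpha$ are black, or all boxes $(i,\alpha)$ with $i_s<i<i_{s+1}$ and $\alpha_0\le\alpha<\alpha_{s+1}$ are black; 6. for each $s\in\{0,\dots,t-1\}$, either all boxes $(i,\alpha)$ with $i_s<i$ and $\alpha_s<\alpha<\alpha_{s+1}$ are black, or all boxes $(i,\alpha)$ with $i<i_{s+1}$ and $\alpha_s<\alpha<\alpha_{s+1}$ are black. **Proposition.** Let $C$ be an $m\times p$ Cauchon diagram and $M$ a real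 $m\times p$ matrix. For every box $(j,\beta)$ fix a lacunary sequence $((j_0,\beta_0),\dots,(j_d,\beta_d))$ with respect to $C$ with $(j_0,\beta_0)=(j,\beta)$, and put $\Delta^C_{j,\beta}(M)=[j_0\dots j_d\,|\,\beta_0\dots\beta_d](M)$. Suppose that one of the following holds: (a) $M$ is tnn and $M\in S^0_C$; (b) for every box $(j,\beta)$, $\Delta^C_{j,\beta}(M)=0$ if $(j,\beta)\in C$, and $\Delta^C_{j,\beta}(M)>0$ if $(j,\beta)\notin C$. Then for every lacunary sequence $((i_0,\alpha_0),\dots,(i_t,\alpha_t))$ with respect to $C$, $$[i_0\dots i_t\,|\,\alpha_0\dots\alpha_t](M)=t_{i_0,\alpha_0}t_{i_1,\alpha_1}\cdots t_{i_t,\alpha_t}.$$ Moreover, under (b), every $t_{i,\alpha}$ is $\ge 0$, and $t_{i,\alpha}=0$ if and only if $(i,\alpha)\in C$. -/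

import Mathlib

namespace TNNCells

/-- An `m × p` Cauchon diagram: a set of black boxes (rows and columns indexed from `0`) such that,
whenever a box is black, all boxes strictly to its left or all boxes strictly above it are black. -/
structure CauchonDiagram (m p : ℕ) where
  black : Set (Fin m × Fin p)
  left_or_above : ∀ i α, (i, α) ∈ black →
    (∀ γ, γ < α → (i, γ) ∈ black) ∨ (∀ k, k < i → (k, α) ∈ black)

/-- A real matrix is totally nonnegative if all its minors are nonnegative. -/
def IsTNN {m p : ℕ} (M : Matrix (Fin m) (Fin p) ℝ) : Prop :=
  ∀ (k : ℕ) (r : Fin k → Fin m) (c : Fin k → Fin p), StrictMono r → StrictMono c →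
    0 ≤ (M.submatrix r c).det

/-- `X` is a Cauchon matrix associated to `C`: its zero entries are exactly at the black boxes. -/
def IsCauchonMatrix {m p : ℕ} (C : CauchonDiagram m p) (X : Matrix (Fin m) (Fin p) ℝ) : Prop :=
  ∀ i α, X i α = 0 ↔ (i, α) ∈ C.black

open Classical in
/-- One step of the Cauchon reduction algorithm, with pivot at the box `b = (j, β)`. -/
noncomputable def reductionStep {m p : ℕ} (b : Fin m × Fin p) (X : Matrix (Fin m) (Fin p) ℝ) :
    Matrix (Fin m) (Fin p) ℝ :=
  if X b.1 b.2 = 0 then X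
  else Matrix.of fun i α =>
    if i < b.1 ∧ α < b.2 then X i α - X i b.2 * (X b.1 b.2)⁻¹ * X b.1 α else X i α

/-- All boxes of the `m × p` grid, listed in increasing lexicographic order. -/
def boxes (m p : ℕ) : List (Fin m × Fin p) :=
  List.product (List.finRange m) (List.finRange p)

/-- The matrix obtained at the end of the Cauchon reduction algorithm: starting from `M`, the
reduction steps are applied at all boxes in decreasing lexicographic order (last box first).
The step at the top left box changes nothing, so it does no harm to include it. -/
noncomputable def cauchonReduction {m p : ℕ} (M : Matrix (Fin m) (Fin p) ℝ) :
    Matrix (Fin m) (Fin p) ℝ :=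
  (boxes m p).foldr reductionStep M

/-- The totally nonnegative cell associated to `C`: the totally nonnegative matrices whose
Cauchon reduction is a Cauchon matrix associated to `C`. -/
def tnnCell {m p : ℕ} (C : CauchonDiagram m p) : Set (Matrix (Fin m) (Fin p) ℝ) :=
  {M | IsTNN M ∧ IsCauchonMatrix C (cauchonReduction M)}

/-- A lacunary sequence `((i_0, α_0), …, (i_t, α_t))` with respect to the Cauchon diagram `C`,
where `i_s = row s` and `α_s = col s`. -/
structure LacunarySeq {m p : ℕ} (C : CauchonDiagram m p) where
  t : ℕ
  row : Fin (t + 1) → Fin m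
  col : Fin (t + 1) → Fin p
  white : ∀ s : Fin (t + 1), s ≠ 0 → (row s, col s) ∉ C.black
  row_strictMono : StrictMono row
  col_strictMono : StrictMono col
  black_after : ∀ i α, row (Fin.last t) < i → col (Fin.last t) < α → (i, α) ∈ C.black
  black_rows : ∀ s : Fin t,
    (∀ i α, row s.castSucc < i → i < row s.succ → col s.castSucc < α → (i, α) ∈ C.black) ∨
    (∀ i α, row s.castSucc < i → i < row s.succ → col 0 ≤ α → α < col s.succ →
      (i, α) ∈ C.black)
  black_cols : ∀ s : Fin t,
    (∀ i α, row s.castSucc < i → col s.castSucc < α → α < col s.succ → (i, α) ∈ C.black) ∨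
    (∀ i α, i < row s.succ → col s.castSucc < α → α < col s.succ → (i, α) ∈ C.black)

/-- The lacunary sequence starts at the box `(j, β)`. -/
def LacunarySeq.StartsAt {m p : ℕ} {C : CauchonDiagram m p} (L : LacunarySeq C)
    (j : Fin m) (β : Fin p) : Prop :=
  L.row 0 = j ∧ L.col 0 = β

/-- The minor `[i_0, …, i_t | α_0, …, α_t](M)` attached to a lacunary sequence. -/
def LacunarySeq.minor {m p : ℕ} {C : CauchonDiagram m p} (L : LacunarySeq C)
    (M : Matrix (Fin m) (Fin p) ℝ) : ℝ :=
  (M.submatrix L.row L.col).det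

/-- For the chosen lacunary sequences `L j β`, the minor of `M` attached to `L j β` is zero if
`(j, β)` is black and positive if `(j, β)` is white. -/
def HasMinorPattern {m p : ℕ} {C : CauchonDiagram m p} (L : Fin m → Fin p → LacunarySeq C)
    (M : Matrix (Fin m) (Fin p) ℝ) : Prop :=
  ∀ j β, ((j, β) ∈ C.black → (L j β).minor M = 0) ∧ ((j, β) ∉ C.black → 0 < (L j β).minor M)

end TNNCells

/-! The pivots in row `j` never alter row `j` or the rows below it, so they act on each higher row
by a linear map whose inverse, `restoreRow`, depends only on the reduced row `j`. Hence row `i` of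
`M` is the reduced row `i` carried through all reduced rows below it (`carry_cauchonReduction`).

A lacunary minor is evaluated by peeling off boxes from the last one. Condition 4 allows every row
to be truncated to the columns up to `α_t` once row `i_t` has acted. Subtracting multiples of row
`i_t` clears column `α_t`; by `indicator_restoreRow_sub` each higher row is then truncated strictly
left of `α_t` before row `i_t` acts. Expansion yields the factor `t_{i_t,α_t}`. Conditions 5 and 6
move the truncation back to the preceding box (`carry_indicator_Iio`), and induction gives the
product (`det_carry_indicator`).

Only the zero pattern weakly below and to the right of the first box, that box excluded, enters.
Under (a) it is given. Under (b) it is found by induction from the bottom right corner: the chosen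
minor at a box is its reduced entry times entries already known to be positive. -/

namespace TNNCells

/-! ### Restoring rows, and truncated minors -/

section Restoration

variable {p : ℕ}

/-- The inverse of a whole row of reduction steps with pivots in the row `t`, acting on the rows
above it. Black boxes of `t` do not contribute because `0⁻¹ = 0`. -/
noncomputable def restoreRow (t : Fin p → ℝ) : (Fin p → ℝ) →ₗ[ℝ] (Fin p → ℝ) where
  toFun y α := y α + t α * ∑ β ∈ Finset.Ioi α, y β * (t β)⁻¹
  map_add' y z := by
    ext α
    simp only [Pi.add_apply, add_mul, Finset.sum_add_distrib]
    ring
  map_smul' c y := by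
    ext α
    simp only [Pi.smul_apply, smul_eq_mul, RingHom.id_apply, mul_assoc, ← Finset.mul_sum]
    ring

theorem restoreRow_apply (t y : Fin p → ℝ) (α : Fin p) :
    restoreRow t y α = y α + t α * ∑ β ∈ Finset.Ioi α, y β * (t β)⁻¹ := rfl

theorem restoreRow_congr (t : Fin p → ℝ) {y z : Fin p → ℝ} {α : Fin p}
    (h : ∀ β, α ≤ β → y β = z β) : restoreRow t y α = restoreRow t z α := by
  rw [restoreRow_apply, restoreRow_apply, h α le_rfl]
  congr 2
  refine Finset.sum_congr rfl fun β hβ => ?_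
  rw [h β (Finset.mem_Ioi.1 hβ).le]

theorem restoreRow_eq_self {t y : Fin p → ℝ} (h : ∀ β, y β = 0 ∨ t β = 0) :
    restoreRow t y = y := by
  ext α
  rw [restoreRow_apply, Finset.sum_eq_zero, mul_zero, add_zero]
  intro β _
  rcases h β with h | h <;> simp [h]

theorem restoreRow_apply_of_eq_zero {t : Fin p → ℝ} {α : Fin p} (h : t α = 0)
    (y : Fin p → ℝ) : restoreRow t y α = y α := by
  rw [restoreRow_apply, h, zero_mul, add_zero]

/-- Clearing the entry in column `c` by means of the pivot `t c` leaves the restoration restricted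
to the columns before `c`. -/
theorem indicator_restoreRow_sub {t : Fin p → ℝ} {c : Fin p} (hc : t c ≠ 0)
    (z : Fin p → ℝ) :
    (Set.Iic c).indicator (restoreRow t z) -
        (restoreRow t z c * (t c)⁻¹) • (Set.Iic c).indicator t =
      restoreRow t ((Set.Iio c).indicator z) := by
  ext α
  simp only [Pi.sub_apply, Pi.smul_apply, smul_eq_mul]
  rcases lt_trichotomy α c with h | rfl | h
  -- The terms with `β ≥ c` add up to the multiplier `restoreRow t z c * (t c)⁻¹`, so the
  -- subtraction removes exactly them.
  · have hs : ∑ β ∈ Finset.Ioi α, z β * (t β)⁻¹ =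
        ∑ β ∈ Finset.Ioi α, (Set.Iio c).indicator z β * (t β)⁻¹ +
          (z c * (t c)⁻¹ + ∑ β ∈ Finset.Ioi c, z β * (t β)⁻¹) := by
      have hd : Finset.Ioi α = Finset.Ioo α c ∪ insert c (Finset.Ioi c) := by
        ext β
        simp only [Finset.mem_Ioi, Finset.mem_union, Finset.mem_Ioo, Finset.mem_insert]
        constructor
        · intro hβ
          rcases lt_trichotomy β c with h' | h' | h' <;> simp [*]
        · rintro (h' | rfl | h')
          exacts [h'.1, h, h.trans h']
      have hdisj : Disjoint (Finset.Ioo α c) (insert c (Finset.Ioi c)) := by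
        rw [Finset.disjoint_left]
        intro β hβ hβ'
        simp only [Finset.mem_Ioo, Finset.mem_insert, Finset.mem_Ioi] at hβ hβ'
        rcases hβ' with rfl | h'
        exacts [lt_irrefl _ hβ.2, lt_asymm hβ.2 h']
      rw [hd, Finset.sum_union hdisj, Finset.sum_union hdisj,
        Finset.sum_insert (by simp), Finset.sum_insert (by simp)]
      have h1 : ∑ β ∈ Finset.Ioo α c, (Set.Iio c).indicator z β * (t β)⁻¹ =
          ∑ β ∈ Finset.Ioo α c, z β * (t β)⁻¹ := by
        refine Finset.sum_congr rfl fun β hβ => ?_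
        rw [Set.indicator_of_mem (Set.mem_Iio.2 (Finset.mem_Ioo.1 hβ).2)]
      have h2 : ∑ β ∈ Finset.Ioi c, (Set.Iio c).indicator z β * (t β)⁻¹ = 0 := by
        refine Finset.sum_eq_zero fun β hβ => ?_
        rw [Set.indicator_of_notMem, zero_mul]
        exact Set.notMem_Iio.2 (Finset.mem_Ioi.1 hβ).le
      rw [h1, h2, Set.indicator_of_notMem (by simp : c ∉ Set.Iio c)]
      ring
    rw [Set.indicator_of_mem (show α ∈ Set.Iic c from h.le),
      Set.indicator_of_mem (show α ∈ Set.Iic c from h.le), restoreRow_apply t z α, hs,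
      restoreRow_apply t z c, restoreRow_apply, Set.indicator_of_mem (show α ∈ Set.Iio c from h)]
    field_simp
    ring
  · rw [Set.indicator_of_mem (by simp), Set.indicator_of_mem (by simp), mul_assoc,
      inv_mul_cancel₀ hc, mul_one, sub_self, restoreRow_congr t (z := 0), map_zero, Pi.zero_apply]
    intro β hβ
    exact Set.indicator_of_notMem (Set.notMem_Iio.2 hβ) _
  · rw [Set.indicator_of_notMem (Set.notMem_Iic.2 h),
      Set.indicator_of_notMem (Set.notMem_Iic.2 h), mul_zero, sub_self, restoreRow_congr t (z := 0), map_zero, Pi.zero_apply]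
    intro β hβ
    exact Set.indicator_of_notMem (Set.notMem_Iio.2 (h.le.trans hβ)) _

/-- The composition of the restorations by the rows `τ j` with `k ≤ j < l`. -/
noncomputable def carry (τ : ℕ → Fin p → ℝ) (k : ℕ) : ℕ → (Fin p → ℝ) →ₗ[ℝ] (Fin p → ℝ)
  | 0 => LinearMap.id
  | l + 1 => if k ≤ l then restoreRow (τ l) ∘ₗ carry τ k l else LinearMap.id

variable (τ : ℕ → Fin p → ℝ)

theorem carry_self (k : ℕ) (y : Fin p → ℝ) : carry τ k k y = y := by
  cases k <;> simp [carry]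

theorem carry_succ {k l : ℕ} (h : k ≤ l) (y : Fin p → ℝ) :
    carry τ k (l + 1) y = restoreRow (τ l) (carry τ k l y) := by
  simp [carry, h]

theorem carry_carry {k l n : ℕ} (h : k ≤ l) (h' : l ≤ n) (y : Fin p → ℝ) :
    carry τ l n (carry τ k l y) = carry τ k n y := by
  induction n, h' using Nat.le_induction with
  | base => rw [carry_self]
  | succ n hn ih => rw [carry_succ τ hn, carry_succ τ (h.trans hn), ih]

theorem carry_eq_restoreRow {k l : ℕ} (h : k < l) (y : Fin p → ℝ) :
    carry τ k l y = carry τ (k + 1) l (restoreRow (τ k) y) := by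
  rw [← carry_carry τ (Nat.le_succ k) h, carry_succ τ le_rfl, carry_self]

variable {τ}

theorem carry_congr {k l : ℕ} (h : k ≤ l) {y z : Fin p → ℝ} {α : Fin p}
    (hyz : ∀ β, α ≤ β → y β = z β) : carry τ k l y α = carry τ k l z α := by
  suffices ∀ β, α ≤ β → carry τ k l y β = carry τ k l z β from this α le_rfl
  induction l, h using Nat.le_induction with
  | base => simpa only [carry_self] using hyz
  | succ l hl ih =>
    intro β hβ
    rw [carry_succ τ hl, carry_succ τ hl]
    exact restoreRow_congr _ fun γ hγ => ih γ (hβ.trans hγ)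

theorem carry_eq_self {k l : ℕ} (h : k ≤ l) {y : Fin p → ℝ}
    (hy : ∀ j, k ≤ j → j < l → ∀ β, y β = 0 ∨ τ j β = 0) : carry τ k l y = y := by
  induction l, h using Nat.le_induction with
  | base => rw [carry_self]
  | succ l hl ih =>
    rw [carry_succ τ hl, ih fun j hj hjl => hy j hj (hjl.trans l.lt_succ_self),
      restoreRow_eq_self (hy l hl l.lt_succ_self)]

theorem carry_apply_of_forall_gt {k l : ℕ} (h : k ≤ l) {α : Fin p} {y : Fin p → ℝ}
    (hy : ∀ β, α < β → y β = 0) : carry τ k l y α = y α := by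
  induction l, h using Nat.le_induction with
  | base => rw [carry_self]
  | succ l hl ih =>
    rw [carry_succ τ hl, restoreRow_apply, ih, Finset.sum_eq_zero, mul_zero, add_zero]
    intro β hβ
    rw [carry_congr hl (z := 0), map_zero, Pi.zero_apply, zero_mul]
    exact fun γ hγ => hy γ ((Finset.mem_Ioi.1 hβ).trans_le hγ)

/-- The correction in column `α` made by a row `t` is a multiple of `t α`. -/
theorem carry_apply_of_eq_zero {k l : ℕ} (h : k ≤ l) {α : Fin p}
    (hα : ∀ j, k ≤ j → j < l → τ j α = 0) (y : Fin p → ℝ) : carry τ k l y α = y α := by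
  induction l, h using Nat.le_induction with
  | base => rw [carry_self]
  | succ l hl ih =>
    rw [carry_succ τ hl, restoreRow_apply_of_eq_zero (hα l hl l.lt_succ_self),
      ih fun j hj hjl => hα j hj (hjl.trans l.lt_succ_self)]

/-- A truncation after the row `b`, to the columns before `d`, may be replaced by a truncation
after the row `a`, to the columns up to `c`, if there are enough zeros in between. -/
theorem carry_indicator_Iio {a b n : ℕ} {c₀ c d : Fin p} (hab : a < b) (hbn : b ≤ n)
    (hcd : c < d) (y : Fin p → ℝ)
    (hrow : (∀ j β, a < j → j < b → c < β → τ j β = 0) ∨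
      (∀ j β, a < j → j < b → c₀ ≤ β → β < d → τ j β = 0))
    (hcol : (∀ j β, a < j → c < β → β < d → τ j β = 0) ∨
      (∀ β, c < β → β < d → y β = 0))
    {α : Fin p} (hα : c₀ ≤ α) (hαc : α ≤ c) :
    carry τ b n ((Set.Iio d).indicator (carry τ (a + 1) b y)) α =
      carry τ (a + 1) n ((Set.Iic c).indicator y) α := by
  have hab' : a + 1 ≤ b := hab
  -- The piece strictly between `c` and `d` is either fixed by the later restorations, hence absent
  -- from column `α ≤ c`, or already zero.
  have hmid : carry τ b n ((Set.Ioo c d).indicator y) α = 0 := by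
    rcases hcol with hcol | hcol
    · rw [carry_eq_self hbn, Set.indicator_of_notMem fun h => not_lt.2 hαc h.1]
      intro j hj _ β
      by_cases hβ : β ∈ Set.Ioo c d
      · exact Or.inr (hcol j β (hab.trans_le hj) hβ.1 hβ.2)
      · exact Or.inl (Set.indicator_of_notMem hβ _)
    · have : (Set.Ioo c d).indicator y = 0 := by
        ext β
        by_cases hβ : β ∈ Set.Ioo c d
        · rw [Set.indicator_of_mem hβ, hcol β hβ.1 hβ.2, Pi.zero_apply]
        · rw [Set.indicator_of_notMem hβ, Pi.zero_apply]
      rw [this, map_zero, Pi.zero_apply]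
  -- Restoration at `α` only sees columns `β ≥ α`. There, the rows between `a` and `b` either fix
  -- the part of `y` right of `c`, or fix all columns from `c₀` up to `d`.
  have hkey : ∀ β, α ≤ β → (Set.Iio d).indicator (carry τ (a + 1) b y) β =
      (carry τ (a + 1) b ((Set.Iic c).indicator y) + (Set.Ioo c d).indicator y) β := by
    intro β hβ
    rw [Pi.add_apply]
    have hout : c < β → carry τ (a + 1) b ((Set.Iic c).indicator y) β = 0 := by
      intro h
      rw [carry_congr hab' (z := 0), map_zero, Pi.zero_apply]
      exact fun γ hγ => Set.indicator_of_notMem (Set.notMem_Iic.2 (h.trans_le hγ)) _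
    rcases hrow with hrow | hrow
    · have hsplit : carry τ (a + 1) b y =
          carry τ (a + 1) b ((Set.Iic c).indicator y) + (Set.Ioi c).indicator y := by
        have hy : y = (Set.Iic c).indicator y + (Set.Ioi c).indicator y := by
          rw [← Set.compl_Iic, Set.indicator_self_add_compl]
        conv_lhs => rw [hy, map_add]
        congr 1
        refine carry_eq_self hab' fun j hj hjb γ => ?_
        by_cases hγ : γ ∈ Set.Ioi c
        · exact Or.inr (hrow j γ hj hjb hγ)
        · exact Or.inl (Set.indicator_of_notMem hγ _)
      rw [hsplit]
      rcases lt_or_ge β d with hd | hd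
      · rw [Set.indicator_of_mem (show β ∈ Set.Iio d from hd), Pi.add_apply]
        congr 1
        simp only [Set.indicator_apply, Set.mem_Ioi, Set.mem_Ioo, hd, and_true]
      · rw [Set.indicator_of_notMem (Set.notMem_Iio.2 hd), hout (hcd.trans_le hd),
          Set.indicator_of_notMem (fun h => not_lt.2 hd h.2), add_zero]
    · rcases lt_or_ge β d with hd | hd
      · have hz : ∀ j, a + 1 ≤ j → j < b → τ j β = 0 :=
          fun j hj hjb => hrow j β hj hjb (hα.trans hβ) hd
        rw [Set.indicator_of_mem (show β ∈ Set.Iio d from hd), carry_apply_of_eq_zero hab' hz,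
          carry_apply_of_eq_zero hab' hz]
        rcases le_or_gt β c with hc | hc
        · rw [Set.indicator_of_mem (show β ∈ Set.Iic c from hc),
            Set.indicator_of_notMem (fun h => not_lt.2 hc h.1), add_zero]
        · rw [Set.indicator_of_notMem (Set.notMem_Iic.2 hc),
            Set.indicator_of_mem (show β ∈ Set.Ioo c d from ⟨hc, hd⟩), zero_add]
      · rw [Set.indicator_of_notMem (Set.notMem_Iio.2 hd), hout (hcd.trans_le hd),
          Set.indicator_of_notMem (fun h => not_lt.2 hd h.2), add_zero]
  rw [carry_congr hbn hkey, map_add, Pi.add_apply, hmid, add_zero, carry_carry τ hab' hbn]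

/-- Evaluation of the truncated minors along a sequence of boxes with nonzero entries. -/
theorem det_carry_indicator (n t : ℕ) (row : Fin (t + 1) → ℕ) (col : Fin (t + 1) → Fin p)
    (hrow : StrictMono row) (hcol : StrictMono col) (hn : ∀ s, row s < n)
    (hne : ∀ s, s ≠ 0 → τ (row s) (col s) ≠ 0)
    (hrows : ∀ s : Fin t,
      (∀ j β, row s.castSucc < j → j < row s.succ → col s.castSucc < β → τ j β = 0) ∨
      (∀ j β, row s.castSucc < j → j < row s.succ → col 0 ≤ β → β < col s.succ → τ j β = 0))
    (hcols : ∀ s : Fin t,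
      (∀ j β, row s.castSucc < j → col s.castSucc < β → β < col s.succ → τ j β = 0) ∨
      (∀ j β, row 0 ≤ j → j < row s.succ → col s.castSucc < β → β < col s.succ → τ j β = 0)) :
    (Matrix.of fun r q => carry τ (row (Fin.last t) + 1) n
      ((Set.Iic (col (Fin.last t))).indicator
        (carry τ (row r + 1) (row (Fin.last t) + 1) (τ (row r)))) (col q)).det =
      ∏ s, τ (row s) (col s) := by
  induction t with
  | zero =>
    refine (Matrix.det_fin_one _).trans ?_
    rw [Fin.prod_univ_one, Matrix.of_apply, Fin.last_zero, carry_self,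
      carry_apply_of_forall_gt (Nat.succ_le_of_lt (hn 0)), Set.indicator_of_mem (by simp)]
    exact fun β hβ => Set.indicator_of_notMem (Set.notMem_Iic.2 hβ) _
  | succ t ih =>
    have hlt : row (Fin.last t).castSucc < row (Fin.last (t + 1)) :=
      hrow (Fin.castSucc_lt_last _)
    have hclt : col (Fin.last t).castSucc < col (Fin.last (t + 1)) :=
      hcol (Fin.castSucc_lt_last _)
    have hnz : τ (row (Fin.last (t + 1))) (col (Fin.last (t + 1))) ≠ 0 :=
      hne _ (Fin.last_pos.ne')
    have ih' := ih (fun s => row s.castSucc) (fun s => col s.castSucc)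
      (hrow.comp Fin.strictMono_castSucc) (hcol.comp Fin.strictMono_castSucc)
      (fun s => hn _) (fun s hs => hne _ (by simpa using hs))
      (fun s => by simpa using hrows s.castSucc) (fun s => by simpa using hcols s.castSucc)
    rw [Fin.prod_univ_castSucc, ← ih']
    generalize hk : row (Fin.last (t + 1)) = k at *
    generalize hc : col (Fin.last (t + 1)) = c at *
    have hkn : k < n := hk ▸ hn _
    have hrk : ∀ r : Fin (t + 1), row r.castSucc < k := fun r =>
      hk ▸ hrow (Fin.castSucc_lt_last _)
    -- These multiples of the last row clear column `c` in the rows above; `B` is the resulting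
    -- matrix.
    set coef : Fin (t + 2) → ℝ := Fin.snoc
      (fun r : Fin (t + 1) => carry τ (row r.castSucc + 1) (k + 1) (τ (row r.castSucc)) c *
        (τ k c)⁻¹) 0 with hcoef
    set B : Matrix (Fin (t + 2)) (Fin (t + 2)) ℝ := Matrix.of (Fin.snoc
      (fun (r : Fin (t + 1)) (q : Fin (t + 2)) => carry τ k n ((Set.Iio c).indicator
        (carry τ (row r.castSucc + 1) k (τ (row r.castSucc)))) (col q))
      (fun q => carry τ (k + 1) n ((Set.Iic c).indicator (τ k)) (col q))) with hB
    have hB1 : ∀ r q, B (Fin.castSucc r) q = carry τ k n ((Set.Iio c).indicator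
        (carry τ (row r.castSucc + 1) k (τ (row r.castSucc)))) (col q) := fun r q => by
      simp [hB]
    have hB2 : ∀ q, B (Fin.last _) q =
        carry τ (k + 1) n ((Set.Iic c).indicator (τ k)) (col q) := fun q => by
      simp [hB]
    rw [Matrix.det_eq_of_forall_row_eq_smul_add_const (B := B) coef (Fin.last _)
      (by simp [hcoef])]
    -- In the last column of `B` only the bottom entry `τ k c` survives, with sign `+1`.
    · rw [Matrix.det_succ_column B (Fin.last _), Fin.sum_univ_castSucc, Finset.sum_eq_zero,
        zero_add, hB2, hc, carry_apply_of_forall_gt (Nat.succ_le_of_lt hkn)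
          (y := (Set.Iic c).indicator (τ k)) (fun β hβ =>
            Set.indicator_of_notMem (Set.notMem_Iic.2 hβ) _),
        Set.indicator_of_mem (by simp), Even.neg_one_pow (by simp), one_mul, mul_comm]
      · congr 2
        ext r q
        rw [Matrix.submatrix_apply, Fin.succAbove_last, hB1, Matrix.of_apply]
        have hrl : row r.castSucc < row (Fin.last t).castSucc + 1 :=
          Nat.lt_succ_of_le (hrow.monotone (Fin.castSucc_le_castSucc_iff.2 (Fin.le_last r)))
        rw [← carry_carry τ hrl hlt, carry_indicator_Iio (c₀ := col 0) hlt hkn.le hclt _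
          (by simpa [hk, hc] using hrows (Fin.last t)) ?_ (hcol.monotone (Fin.zero_le _))
          (hcol.monotone (Fin.castSucc_le_castSucc_iff.2 (Fin.le_last q)))]
        have h := hcols (Fin.last t)
        rw [Fin.succ_last, hk, hc] at h
        refine h.imp id fun h β hβ hβc => ?_
        have h0 : row 0 ≤ row r.castSucc := hrow.monotone (Fin.zero_le _)
        -- Row `r` and all rows restoring it so far vanish in column `β`, so the partially restored
        -- row does too.
        rw [carry_apply_of_eq_zero hrl]
        · exact h _ β h0 (hrk r) hβ hβc
        · exact fun j hj hj' => h j β (h0.trans (Nat.le_of_succ_le hj)) (hj'.trans_le hlt) hβ hβc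
      · intro r _
        rw [hB1, hc, carry_congr hkn.le (z := 0), map_zero, Pi.zero_apply, mul_zero, zero_mul]
        exact fun β hβ => Set.indicator_of_notMem (Set.notMem_Iio.2 hβ) _
    · intro r q
      induction r using Fin.lastCases with
      | last => simp [hB2, hcoef, hk, carry_self]
      | cast r =>
        rw [hB1, hB2, Matrix.of_apply, carry_eq_restoreRow τ hkn,
          ← indicator_restoreRow_sub hnz, ← carry_succ τ (hrk r), map_sub, map_smul]
        simp [hcoef]

end Restoration

/-! ### Cauchon reduction and lacunary minors -/

section Reduction

variable {m p : ℕ}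

theorem reductionStep_apply (b : Fin m × Fin p) (X : Matrix (Fin m) (Fin p) ℝ) (i : Fin m)
    (α : Fin p) : reductionStep b X i α =
      if i < b.1 ∧ α < b.2 then X i α - X i b.2 * (X b.1 b.2)⁻¹ * X b.1 α else X i α := by
  unfold reductionStep
  by_cases h : X b.1 b.2 = 0 <;> simp [h]

/-- The reduction steps with pivots in the row `j`. -/
noncomputable def reduceRow (j : Fin m) (X : Matrix (Fin m) (Fin p) ℝ) :
    Matrix (Fin m) (Fin p) ℝ :=
  (List.finRange p).foldr (fun β Y => reductionStep (j, β) Y) X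

theorem cauchonReduction_eq_foldr (M : Matrix (Fin m) (Fin p) ℝ) :
    cauchonReduction M = (List.finRange m).foldr reduceRow M := by
  simp only [cauchonReduction, boxes, List.product, List.foldr_flatMap, List.foldr_map]
  rfl

theorem foldr_reductionStep_of_le (j : Fin m) (l : List (Fin p)) (X : Matrix (Fin m) (Fin p) ℝ)
    {i : Fin m} (h : j ≤ i) :
    l.foldr (fun β Y => reductionStep (j, β) Y) X i = X i := by
  induction l with
  | nil => rfl
  | cons c l ih =>
    ext α
    rw [List.foldr_cons, reductionStep_apply, if_neg fun h' => not_lt.2 h h'.1, ih]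

/-- Pivots run from right to left and change only columns to their left, so the entry in column `β`
used by the pivot there is already the final one for row `j`. Adding back the subtracted terms
recovers `X i α`. -/
theorem foldr_reductionStep_of_lt {j : Fin m} {l : List (Fin p)} (hl : l.Pairwise (· < ·))
    (X : Matrix (Fin m) (Fin p) ℝ) {i : Fin m} (h : i < j) (α : Fin p) :
    X i α = l.foldr (fun β Y => reductionStep (j, β) Y) X i α +
      X j α * ∑ β ∈ l.toFinset with α < β,
        l.foldr (fun β Y => reductionStep (j, β) Y) X i β * (X j β)⁻¹ := by
  induction l with
  | nil => simp
  | cons c l ih =>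
    obtain ⟨hc, hl⟩ := List.pairwise_cons.1 hl
    have hj := foldr_reductionStep_of_le j l X le_rfl
    rw [ih hl]
    simp only [List.foldr_cons, reductionStep_apply, h, true_and, hj]
    -- The columns in `l` lie right of `c`, so the step at `c` leaves them unchanged.
    have hs : ∀ γ : Fin p, ∑ β ∈ l.toFinset with γ < β,
        (if β < c then l.foldr (fun β Y => reductionStep (j, β) Y) X i β -
          l.foldr (fun β Y => reductionStep (j, β) Y) X i c * (X j c)⁻¹ * X j β
          else l.foldr (fun β Y => reductionStep (j, β) Y) X i β) * (X j β)⁻¹ =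
        ∑ β ∈ l.toFinset with γ < β,
          l.foldr (fun β Y => reductionStep (j, β) Y) X i β * (X j β)⁻¹ := by
      intro γ
      refine Finset.sum_congr rfl fun β hβ => ?_
      rw [if_neg (not_lt.2 (hc β (by simpa using (Finset.mem_filter.1 hβ).1)).le)]
    rw [List.toFinset_cons, Finset.filter_insert]
    split_ifs with hαc
    · rw [Finset.sum_insert, hs, if_neg (lt_irrefl c)]
      · ring
      · intro hmem
        exact lt_irrefl c (hc c (by simpa using (Finset.mem_filter.1 hmem).1))
    · rw [hs]

theorem reduceRow_of_le {j i : Fin m} (h : j ≤ i) (X : Matrix (Fin m) (Fin p) ℝ) :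
    reduceRow j X i = X i :=
  foldr_reductionStep_of_le j _ X h

theorem restoreRow_reduceRow {j i : Fin m} (h : i < j) (X : Matrix (Fin m) (Fin p) ℝ) :
    restoreRow (X j) (reduceRow j X i) = X i := by
  ext α
  rw [restoreRow_apply, foldr_reductionStep_of_lt (List.pairwise_lt_finRange p) X h α]
  have : ({β ∈ (List.finRange p).toFinset | α < β} : Finset (Fin p)) = Finset.Ioi α := by
    ext β
    simp
  rw [this]
  rfl

/-- The rows of `X`, continued by zero rows. -/
def extendRows (X : Matrix (Fin m) (Fin p) ℝ) (j : ℕ) : Fin p → ℝ :=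
  if h : j < m then X ⟨j, h⟩ else 0

theorem extendRows_coe (X : Matrix (Fin m) (Fin p) ℝ) (i : Fin m) :
    extendRows X i = X i := by
  simp [extendRows]

/-- Every row of a matrix is recovered from the reduced matrix by successive restorations. -/
theorem carry_cauchonReduction (M : Matrix (Fin m) (Fin p) ℝ) (i : Fin m) :
    carry (extendRows (cauchonReduction M)) (i + 1) m (cauchonReduction M i) = M i := by
  -- `X k` is the matrix after all pivots in rows `≥ k`.
  set X : ℕ → Matrix (Fin m) (Fin p) ℝ := fun k => ((List.finRange m).drop k).foldr reduceRow M
    with hX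
  have hstep : ∀ k (h : k < m), X k = reduceRow ⟨k, h⟩ (X (k + 1)) := by
    intro k h
    simp only [hX]
    rw [List.drop_eq_getElem_cons (by simpa using h), List.foldr_cons, List.getElem_finRange]
    rfl
  have h0 : X 0 = cauchonReduction M := by simp [hX, cauchonReduction_eq_foldr]
  have hm : X m = M := by
    simp only [hX]
    rw [List.drop_of_length_le (by simp), List.foldr_nil]
  -- The bound is `j + 1`, not `j`, because pivots in row `j` do not alter row `j`.
  have hfinal : ∀ (k : ℕ) (j : Fin m), k ≤ (j : ℕ) + 1 → X k j = cauchonReduction M j := by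
    intro k j
    induction k with
    | zero => rw [h0]; exact fun _ => rfl
    | succ k ih =>
      intro hk
      have hkj : k ≤ j := Nat.le_of_succ_le_succ hk
      rw [← ih (hkj.trans (Nat.le_succ _)), hstep k (hkj.trans_lt j.2), reduceRow_of_le hkj]
  have hcarry : ∀ k, (i : ℕ) + 1 ≤ k → k ≤ m →
      carry (extendRows (cauchonReduction M)) (i + 1) k (cauchonReduction M i) = X k i := by
    intro k hk
    induction k, hk using Nat.le_induction with
    | base => intro _; rw [carry_self, hfinal _ _ le_rfl]
    | succ k hk ih =>
      intro hkm
      have hkm' : k < m := hkm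
      have hik : i < ⟨k, hkm'⟩ := hk
      rw [carry_succ _ hk, ih hkm'.le, ← restoreRow_reduceRow hik (X (k + 1)), ← hstep,
        hfinal (k + 1) ⟨k, hkm'⟩ le_rfl, extendRows, dif_pos hkm']
  rw [hcarry m i.2 le_rfl, hm]

/-- The minor of a lacunary sequence is the product of the reduced entries along it, as soon as
the reduced matrix has the right zeros to the right of and below the first box. -/
theorem LacunarySeq.minor_eq_prod {C : CauchonDiagram m p} (S : LacunarySeq C)
    (M : Matrix (Fin m) (Fin p) ℝ)
    (h : ∀ b : Fin m × Fin p, (S.row 0, S.col 0) < b →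
      (cauchonReduction M b.1 b.2 = 0 ↔ b ∈ C.black)) :
    S.minor M = ∏ s, cauchonReduction M (S.row s) (S.col s) := by
  have hrow0 : ∀ s, (S.row 0 : ℕ) ≤ S.row s := fun s =>
    S.row_strictMono.monotone (Fin.zero_le _)
  have hcol0 : ∀ s, S.col 0 ≤ S.col s := fun s => S.col_strictMono.monotone (Fin.zero_le _)
  set τ := extendRows (cauchonReduction M) with hτ
  have hzero_right : ∀ (j : ℕ) (β : Fin p), (S.row 0 : ℕ) ≤ j → S.col 0 < β →
      (∀ hj : j < m, (⟨j, hj⟩, β) ∈ C.black) → τ j β = 0 := by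
    intro j β h0 hβ hb
    by_cases hj : j < m
    · rw [hτ, extendRows, dif_pos hj]
      exact (h (⟨j, hj⟩, β) (Prod.mk_lt_mk.2 (Or.inr ⟨h0, hβ⟩))).2 (hb hj)
    · rw [hτ, extendRows, dif_neg hj, Pi.zero_apply]
  have hzero_below : ∀ (j : ℕ) (β : Fin p), (S.row 0 : ℕ) < j → S.col 0 ≤ β →
      (∀ hj : j < m, (⟨j, hj⟩, β) ∈ C.black) → τ j β = 0 := by
    intro j β h0 hβ hb
    by_cases hj : j < m
    · rw [hτ, extendRows, dif_pos hj]
      exact (h (⟨j, hj⟩, β) (Prod.mk_lt_mk.2 (Or.inl ⟨h0, hβ⟩))).2 (hb hj)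
    · rw [hτ, extendRows, dif_neg hj, Pi.zero_apply]
  have hdet := det_carry_indicator (τ := τ) m S.t (fun s => S.row s) S.col
    S.row_strictMono S.col_strictMono (fun s => (S.row s).2)
    (fun s hs => by
      have hs0 : 0 < s := Fin.pos_iff_ne_zero.2 hs
      have hlt : (S.row 0, S.col 0) < (S.row s, S.col s) :=
        Prod.mk_lt_mk.2 (Or.inl ⟨S.row_strictMono hs0, hcol0 s⟩)
      rw [hτ, extendRows_coe]
      exact fun h' => S.white s hs ((h _ hlt).1 h'))
    (fun s => (S.black_rows s).imp
      (fun hb j β h1 h2 h3 => hzero_right j β ((hrow0 _).trans_lt h1).le ((hcol0 _).trans_lt h3)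
        fun hj => hb ⟨j, hj⟩ β h1 h2 h3)
      (fun hb j β h1 h2 h3 h4 => hzero_below j β ((hrow0 _).trans_lt h1) h3
        fun hj => hb ⟨j, hj⟩ β h1 h2 h3 h4))
    (fun s => (S.black_cols s).imp
      (fun hb j β h1 h2 h3 => hzero_right j β ((hrow0 _).trans_lt h1).le ((hcol0 _).trans_lt h2)
        fun hj => hb ⟨j, hj⟩ β h1 h2 h3)
      (fun hb j β h1 h2 h3 h4 => hzero_right j β h1 ((hcol0 _).trans_lt h3)
        fun hj => hb ⟨j, hj⟩ β h2 h3 h4))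
  simp only [hτ, extendRows_coe] at hdet
  rw [← hdet, LacunarySeq.minor]
  congr 1
  ext r q
  have hrl : S.row r ≤ S.row (Fin.last S.t) := S.row_strictMono.monotone (Fin.le_last r)
  rw [Matrix.submatrix_apply, Matrix.of_apply, ← carry_cauchonReduction M (S.row r),
    ← carry_carry _ (Nat.succ_le_succ hrl) (S.row (Fin.last S.t)).2, ← hτ]
  -- By condition 4 the part of `y` beyond the last column is fixed by the remaining restorations,
  -- so it does not reach the columns of the minor.
  set y := carry τ (S.row r + 1) (S.row (Fin.last S.t) + 1) (cauchonReduction M (S.row r))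
  have hy : y = (Set.Iic (S.col (Fin.last S.t))).indicator y +
      (Set.Ioi (S.col (Fin.last S.t))).indicator y := by
    rw [← Set.compl_Iic, Set.indicator_self_add_compl]
  conv_lhs => rw [hy, map_add, Pi.add_apply]
  rw [carry_eq_self (y := (Set.Ioi _).indicator y) (S.row (Fin.last S.t)).2,
    Set.indicator_of_notMem (Set.notMem_Ioi.2 (S.col_strictMono.monotone (Fin.le_last q))), add_zero]
  intro j hj _ β
  by_cases hβ : β ∈ Set.Ioi (S.col (Fin.last S.t))
  · exact Or.inr (hzero_right j β ((hrow0 (Fin.last S.t)).trans_lt hj).le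
      ((hcol0 _).trans_lt hβ) fun hj' => S.black_after ⟨j, hj'⟩ β hj hβ)
  · exact Or.inl (Set.indicator_of_notMem hβ _)

/-- The signs of the chosen minors determine the signs of the entries of the reduced matrix. -/
theorem HasMinorPattern.cauchonReduction_pattern {C : CauchonDiagram m p}
    {L : Fin m → Fin p → LacunarySeq C} {M : Matrix (Fin m) (Fin p) ℝ}
    (hL : ∀ j β, (L j β).StartsAt j β) (hM : HasMinorPattern L M) (b : Fin m × Fin p) :
    (b ∈ C.black → cauchonReduction M b.1 b.2 = 0) ∧
      (b ∉ C.black → 0 < cauchonReduction M b.1 b.2) := by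
  induction b using WellFoundedGT.induction with
  | ind b ih =>
    obtain ⟨j, β⟩ := b
    obtain ⟨h1, h2⟩ := hL j β
    set S := L j β with hS
    -- The later boxes of `S` are white and larger than `(j, β)` in the product order, so the
    -- induction hypothesis applies to each.
    have hpos : 0 < ∏ s : Fin S.t, cauchonReduction M (S.row s.succ) (S.col s.succ) := by
      refine Finset.prod_pos fun s _ => (ih (S.row s.succ, S.col s.succ) ?_).2
        (S.white _ (Fin.succ_ne_zero s))
      rw [← h1, ← h2]
      exact Prod.mk_lt_mk.2 (Or.inl ⟨S.row_strictMono s.succ_pos,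
        (S.col_strictMono s.succ_pos).le⟩)
    have hminor := S.minor_eq_prod M fun b hb => by
      rw [h1, h2] at hb
      refine ⟨fun h => ?_, (ih b hb).1⟩
      by_contra hw
      exact ((ih b hb).2 hw).ne' h
    rw [Fin.prod_univ_succ, h1, h2] at hminor
    refine ⟨fun hb => ?_, fun hb => ?_⟩
    · have h := (hM j β).1 hb
      rw [← hS, hminor] at h
      exact (mul_eq_zero.1 h).resolve_right hpos.ne'
    · have h := (hM j β).2 hb
      rw [← hS, hminor] at h
      exact (mul_pos_iff_of_pos_right hpos).1 h

end Reduction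

end TNNCells

theorem proposition4p1 {m p : ℕ} (C : TNNCells.CauchonDiagram m p)
    (M : Matrix (Fin m) (Fin p) ℝ)
    (L : Fin m → Fin p → TNNCells.LacunarySeq C) (hL : ∀ j β, (L j β).StartsAt j β) :
    ((M ∈ TNNCells.tnnCell C ∨ TNNCells.HasMinorPattern L M) →
      ∀ S : TNNCells.LacunarySeq C,
        S.minor M = ∏ s, TNNCells.cauchonReduction M (S.row s) (S.col s)) ∧
    (TNNCells.HasMinorPattern L M →
      ∀ i α, 0 ≤ TNNCells.cauchonReduction M i α ∧
        (TNNCells.cauchonReduction M i α = 0 ↔ (i, α) ∈ C.black)) := by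
  have hpattern : TNNCells.HasMinorPattern L M → ∀ i α, 0 ≤ TNNCells.cauchonReduction M i α ∧
      (TNNCells.cauchonReduction M i α = 0 ↔ (i, α) ∈ C.black) := by
    intro hM i α
    obtain ⟨hb, hw⟩ := hM.cauchonReduction_pattern hL (i, α)
    by_cases h : (i, α) ∈ C.black
    · exact ⟨(hb h).ge, iff_of_true (hb h) h⟩
    · exact ⟨(hw h).le, iff_of_false (hw h).ne' h⟩
  refine ⟨?_, hpattern⟩
  rintro (hM | hM) S
  · exact S.minor_eq_prod M fun b _ => hM.2 b.1 b.2
  · exact S.minor_eq_prod M fun b _ => (hpattern hM b.1 b.2).2
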